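/- Let $G=(V,E)$ be a finite simple undirected graph, let $R\subseteq V$ be a set of terminals, and let $r\in R$ be a fixed root. Suppose that $G$ is quasi-bipartite, i.e. no two Steiner vertices (vertices in $V\setminus R$) are adjacent. Let $A$ be the set of arcs obtained by replacing each edge $uv\in E$ by the two arcs $(u,v)$ and $(v,u)$. For $U\subseteq V$ let $\delta^+(U)$ be the set of arcs with tail in $U$ and head outside $U$, and call $U$ valid if $U\cap R\neq\emptyset$ and $r\notin U$. Let $f:2^R\to\mathbb{R}$ be intersecting supermodular, i.e. $f(A)+f(B)\le f(A\cap B)+f(A\cup B)$ for all $A,B\subseteq R$ with $A\cap B\ne\emptyset$. A vector $x\in\mathbb{R}^A$ is feasible for $\mathrm{BCR}_f$ if $x\ge 0$ and $\sum_{a\in\delta^+(U)}x_a\ge f(U\cap R)$ for every valid $U\subseteq V$. It is minimally feasible if, in addition, no other feasible vector is componentwise at most $x$. A directed full component $K$ is a subtree of $G$ with at least one edge whose leaves are terminals and whose internal vertices are Steiner vertices, together with one of its terminals, the sink; all its edges are oriented towards the sink. Its other terminals are its sources. We also write $K$ for its set of arcs, and $\chi_K\in\{0,1\}^A$ for the characteristic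 vector of that set. $K$ crosses $U\subseteq R$ if its sink lies outside $U$ and at least one of its sources lies in $U$. For $\lambda>0$ let $f'=f'_{\lambda,K}:2^R\to\mathbb{R}$ be given by $f'(U)=f(U)-\lambda$ if $K$ crosses $U$, and $f'(U)=f(U)$ otherwise. Let $x$ be a minimally feasible vector for $\mathrm{BCR}_f$, and let $vu\in A$ be an arc with $v\notin R$, $u\in R$ and $x_{vu}>0$. Then there exist $\lambda>0$ and a directed full component $K$ with $vu\in K$ such that $x-\lambda\chi_K$ is minimally feasible for $\mathrm{BCR}_{f'}$, where $f'=f'_{\lambda,K}$. Moreover, for all such $\lambda$ and $K$, the function $f'$ is again intersecting supermodular. -/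

import Mathlib

/-- No two Steiner vertices (vertices outside the terminal set `R`) are adjacent. -/
def QuasiBipartite {V : Type*} (G : SimpleGraph V) (R : Finset V) : Prop :=
  ∀ ⦃v w : V⦄, G.Adj v w → v ∈ R ∨ w ∈ R

/-- `U` contains some terminal, but not the root `r`. -/
def ValidSet {V : Type*} (R : Finset V) (r : V) (U : Finset V) : Prop :=
  (∃ t ∈ U, t ∈ R) ∧ r ∉ U

/-- `f(A) + f(B) ≤ f(A ∩ B) + f(A ∪ B)` for all intersecting sets `A, B` of terminals. Only the
values of `f` on subsets of `R` matter. -/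
def IntersectingSupermodular {V : Type*} [DecidableEq V] (R : Finset V) (f : Finset V → ℝ) :
    Prop :=
  ∀ ⦃A B : Finset V⦄, A ⊆ R → B ⊆ R → (A ∩ B).Nonempty →
    f A + f B ≤ f (A ∩ B) + f (A ∪ B)

/-- `x(δ⁺(U))`: the total value of `x` on the arcs leaving `U`. The arcs of the bidirected graph
of `G` are the darts of `G`, i.e. the ordered pairs of adjacent vertices. -/
def outFlow {V : Type*} [Fintype V] [DecidableEq V] (G : SimpleGraph V) [DecidableRel G.Adj]
    (x : G.Dart → ℝ) (U : Finset V) : ℝ :=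
  ∑ a : G.Dart with a.fst ∈ U ∧ a.snd ∉ U, x a

/-- Feasibility for the linear program `BCR_f`. -/
def FeasibleBCR {V : Type*} [Fintype V] [DecidableEq V] (G : SimpleGraph V) [DecidableRel G.Adj]
    (R : Finset V) (r : V) (f : Finset V → ℝ) (x : G.Dart → ℝ) : Prop :=
  (∀ a, 0 ≤ x a) ∧ ∀ U : Finset V, ValidSet R r U → f (U ∩ R) ≤ outFlow G x U

/-- A directed full component: a subtree of `G` whose leaves (vertices of degree one) are
terminals and whose other vertices are Steiner vertices, with a distinguished terminal, the
sink. (A one-vertex tree is excluded, since the sink is a terminal and so has degree one.) -/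
structure DirectedFullComponent {V : Type*} (G : SimpleGraph V) (R : Finset V) where
  tree : G.Subgraph
  isTree : tree.coe.IsTree
  mem_terminals_iff : ∀ v ∈ tree.verts, v ∈ R ↔ (tree.neighborSet v).ncard = 1
  sink : V
  sink_mem_tree : sink ∈ tree.verts
  sink_mem_terminals : sink ∈ R

namespace DirectedFullComponent

/-- The arcs of the component: all edges of its tree, oriented towards the sink. -/
def arcs {V : Type*} {G : SimpleGraph V} {R : Finset V} (K : DirectedFullComponent G R) :
    Set G.Dart :=
  {a | K.tree.Adj a.fst a.snd ∧
    K.tree.spanningCoe.dist a.snd K.sink < K.tree.spanningCoe.dist a.fst K.sink}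

/-- The characteristic vector `χ_K` of the arcs of the component. -/
noncomputable def chi {V : Type*} {G : SimpleGraph V} {R : Finset V}
    (K : DirectedFullComponent G R) : G.Dart → ℝ :=
  K.arcs.indicator 1

/-- The sources of the component: its terminals other than the sink. -/
def sources {V : Type*} {G : SimpleGraph V} {R : Finset V} (K : DirectedFullComponent G R) :
    Set V :=
  {w | w ∈ K.tree.verts ∧ w ∈ R ∧ w ≠ K.sink}

/-- The component crosses `U`: its sink lies outside `U` and at least one source lies in `U`. -/
def Crosses {V : Type*} {G : SimpleGraph V} {R : Finset V} (K : DirectedFullComponent G R)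
    (U : Finset V) : Prop :=
  K.sink ∉ U ∧ ∃ w ∈ K.sources, w ∈ U

end DirectedFullComponent

open scoped Classical in
/-- The function obtained from `f` by reducing `f(U)` by `lam` for all `U` crossed by `K`. -/
noncomputable def lowerOnCrossed {V : Type*} {G : SimpleGraph V} {R : Finset V}
    (f : Finset V → ℝ) (lam : ℝ) (K : DirectedFullComponent G R) : Finset V → ℝ :=
  fun U => if K.Crosses U then f U - lam else f U

/-! A feasible vector is minimal exactly when each positive arc leaves a tight set. So it suffices
to find `K`, supported on positive arcs, such that every tight `U` is left by one arc of `K` if `K`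
crosses `U ∩ R` and by none otherwise: for small `λ` all tight sets then stay tight and the slack
constraints survive (`exists_minimal_sub_smul_chi`).

`K` is a star centred at `v` with sink `u`. Tight sets sharing a terminal can be uncrossed, so the
minimal tight sets left by `vu` have pairwise disjoint terminals. Each contains the tail of a
positive arc into `v`; one such tail per minimal set becomes a source (`exists_source_set`). The
delicate point is that a tight set avoiding `v` contains at most one source
(`eq_of_minimal_of_inter_nonempty`): by quasi-bipartiteness the flow between `v` and a set depends
only on the terminals of the set, and two sources would force incompatible balance equations at `v`.
-/

/-! ### Stars as directed full components. -/

section Star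

variable {V : Type*} {G : SimpleGraph V}

/-- The subgraph formed by the edges joining `v` to the vertices of a set `L` of its neighbors. -/
def starSubgraph (v : V) (L : Set V) (hL : ∀ w ∈ L, G.Adj v w) : G.Subgraph where
  verts := insert v L
  Adj a b := (a = v ∧ b ∈ L) ∨ (b = v ∧ a ∈ L)
  adj_sub := by
    rintro a b (⟨rfl, h⟩ | ⟨rfl, h⟩)
    · exact hL _ h
    · exact (hL _ h).symm
  edge_vert := by
    rintro a b (⟨rfl, -⟩ | ⟨-, h⟩)
    · exact Set.mem_insert _ _
    · exact Set.mem_insert_of_mem _ h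
  symm := ⟨fun a b h => h.symm⟩

variable {v : V} {L : Set V} {hL : ∀ w ∈ L, G.Adj v w}

lemma starSubgraph_adj {a b : V} :
    (starSubgraph v L hL).Adj a b ↔ (a = v ∧ b ∈ L) ∨ (b = v ∧ a ∈ L) := Iff.rfl

lemma starSubgraph_isTree : (starSubgraph v L hL).coe.IsTree := by
  have hv : v ∉ L := fun h => (hL v h).ne rfl
  have hs : (starSubgraph v L hL).coe = SimpleGraph.starGraph ⟨v, Set.mem_insert v L⟩ := by
    ext ⟨a, ha⟩ ⟨b, hb⟩
    simp only [SimpleGraph.Subgraph.coe_adj, SimpleGraph.starGraph_adj, starSubgraph_adj, ne_eq,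
      Subtype.mk.injEq]
    change a ∈ insert v L at ha
    change b ∈ insert v L at hb
    rw [Set.mem_insert_iff] at ha hb
    constructor
    · rintro (⟨rfl, h⟩ | ⟨rfl, h⟩)
      · exact ⟨fun h' => hv (h' ▸ h), Or.inl rfl⟩
      · exact ⟨fun h' => hv (h' ▸ h), Or.inr rfl⟩
    · rintro ⟨hne, h | h⟩ <;> cases h
      · exact Or.inl ⟨rfl, hb.resolve_left (fun h => hne h.symm)⟩
      · exact Or.inr ⟨rfl, ha.resolve_left hne⟩
  rw [hs]
  exact SimpleGraph.isTree_starGraph _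

lemma starSubgraph_neighborSet_center :
    (starSubgraph v L hL).neighborSet v = L := by
  have hv : v ∉ L := fun h => (hL v h).ne rfl
  ext b
  simp only [SimpleGraph.Subgraph.mem_neighborSet, starSubgraph_adj]
  tauto

lemma starSubgraph_neighborSet_leaf {w : V} (hw : w ∈ L) :
    (starSubgraph v L hL).neighborSet w = {v} := by
  have hwv : w ≠ v := (hL w hw).ne.symm
  ext b
  simp only [SimpleGraph.Subgraph.mem_neighborSet, starSubgraph_adj, Set.mem_singleton_iff]
  tauto

/-- The full component with Steiner vertex `v`, set of terminals `L` and sink `u ∈ L`. -/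
def starComponent {R : Finset V} (v : V) (L : Set V) (hL : ∀ w ∈ L, G.Adj v w) (hv : v ∉ R)
    (hLR : ∀ w ∈ L, w ∈ R) (hcard : L.ncard ≠ 1) (u : V) (hu : u ∈ L) :
    DirectedFullComponent G R where
  tree := starSubgraph v L hL
  isTree := starSubgraph_isTree
  mem_terminals_iff := by
    rintro w (rfl | hw)
    · simp [starSubgraph_neighborSet_center, hv, hcard]
    · simp [starSubgraph_neighborSet_leaf hw, hLR w hw]
  sink := u
  sink_mem_tree := Set.mem_insert_of_mem _ hu
  sink_mem_terminals := hLR u hu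

lemma mem_arcs_starComponent {R : Finset V} {hv : v ∉ R} {hLR : ∀ w ∈ L, w ∈ R}
    {hcard : L.ncard ≠ 1} {u : V} {hu : u ∈ L} {a : G.Dart} :
    a ∈ (starComponent v L hL hv hLR hcard u hu).arcs ↔
      (a.fst = v ∧ a.snd = u) ∨ (a.fst ∈ L ∧ a.fst ≠ u ∧ a.snd = v) := by
  have hvL : v ∉ L := fun h => (hL v h).ne rfl
  set T := (starSubgraph v L hL).spanningCoe with hT
  have hadj : ∀ {a b : V}, T.Adj a b ↔ (a = v ∧ b ∈ L) ∨ (b = v ∧ a ∈ L) := Iff.rfl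
  have hvu : T.dist v u = 1 := SimpleGraph.dist_eq_one_iff_adj.2 (hadj.2 (Or.inl ⟨rfl, hu⟩))
  have hleaf : ∀ w ∈ L, w ≠ u → 1 < T.dist w u := by
    intro w hw hwu
    -- Reachability matters because `dist` is 0 between unreachable vertices.
    have hreach : T.Reachable w u :=
      (SimpleGraph.Adj.reachable (hadj.2 (Or.inr ⟨rfl, hw⟩))).trans
        (SimpleGraph.Adj.reachable (hadj.2 (Or.inl ⟨rfl, hu⟩)))
    have h0 := hreach.pos_dist_of_ne hwu
    have h1 : T.dist w u ≠ 1 := by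
      rw [Ne, SimpleGraph.dist_eq_one_iff_adj, hadj]
      rintro (⟨rfl, -⟩ | ⟨rfl, -⟩)
      · exact hvL hw
      · exact hvL hu
    omega
  change (((a.fst = v ∧ a.snd ∈ L) ∨ (a.snd = v ∧ a.fst ∈ L)) ∧
    T.dist a.snd u < T.dist a.fst u) ↔ _
  constructor
  · rintro ⟨⟨h1, h2⟩ | ⟨h1, h2⟩, hlt⟩
    · left
      refine ⟨h1, ?_⟩
      by_contra hne
      have := hleaf _ h2 hne
      rw [h1, hvu] at hlt
      omega
    · right
      refine ⟨h2, ?_, h1⟩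
      intro h
      rw [h, SimpleGraph.dist_self] at hlt
      omega
  · rintro (⟨h1, h2⟩ | ⟨h1, h2, h3⟩)
    · exact ⟨Or.inl ⟨h1, h2 ▸ hu⟩, by rw [h1, h2, hvu, SimpleGraph.dist_self]; omega⟩
    · exact ⟨Or.inr ⟨h3, h1⟩, by rw [h3, hvu]; exact hleaf _ h1 h2⟩

end Star

/-! ### Lowering on crossed sets preserves supermodularity. -/

/-- At least as many of `A`, `B` are crossed as of `A ∩ B`, `A ∪ B`, so the left side drops by at
least as much as the right. -/
lemma IntersectingSupermodular.lowerOnCrossed {V : Type*} [DecidableEq V] {G : SimpleGraph V}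
    {R : Finset V} {f : Finset V → ℝ} (hf : IntersectingSupermodular R f) {lam : ℝ}
    (hlam : 0 ≤ lam) (K : DirectedFullComponent G R) :
    IntersectingSupermodular R (lowerOnCrossed f lam K) := by
  intro A B hA hB hAB
  have h := hf hA hB hAB
  have hinter : K.Crosses (A ∩ B) → K.Crosses A ∨ K.Crosses B := by
    rintro ⟨hs, w, hw, hwAB⟩
    rw [Finset.mem_inter] at hs hwAB
    by_cases hsA : K.sink ∈ A
    · exact Or.inr ⟨fun hsB => hs ⟨hsA, hsB⟩, w, hw, hwAB.2⟩
    · exact Or.inl ⟨hsA, w, hw, hwAB.1⟩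
  have hunion : K.Crosses (A ∪ B) → K.Crosses A ∨ K.Crosses B := by
    rintro ⟨hs, w, hw, hwAB⟩
    rw [Finset.mem_union, not_or] at hs
    rw [Finset.mem_union] at hwAB
    exact hwAB.imp (fun h => ⟨hs.1, w, hw, h⟩) (fun h => ⟨hs.2, w, hw, h⟩)
  have hboth : K.Crosses (A ∩ B) → K.Crosses (A ∪ B) → K.Crosses A ∧ K.Crosses B := by
    rintro ⟨-, w, hw, hwAB⟩ ⟨hs, -⟩
    rw [Finset.mem_union, not_or] at hs
    rw [Finset.mem_inter] at hwAB
    exact ⟨⟨hs.1, w, hw, hwAB.1⟩, ⟨hs.2, w, hw, hwAB.2⟩⟩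
  unfold _root_.lowerOnCrossed
  split_ifs <;> first | linarith | tauto

section ValidSet

variable {V : Type*} [DecidableEq V] {R : Finset V} {r : V} {A B : Finset V}

lemma ValidSet.inter (hA : ValidSet R r A) (h : (A ∩ B ∩ R).Nonempty) : ValidSet R r (A ∩ B) := by
  obtain ⟨t, ht⟩ := h
  rw [Finset.mem_inter] at ht
  exact ⟨⟨t, ht⟩, fun hr => hA.2 (Finset.mem_inter.1 hr).1⟩

lemma ValidSet.union (hA : ValidSet R r A) (hB : ValidSet R r B) : ValidSet R r (A ∪ B) := by
  obtain ⟨⟨t, ht, htR⟩, hrA⟩ := hA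
  refine ⟨⟨t, Finset.mem_union_left _ ht, htR⟩, fun hr => ?_⟩
  exact (Finset.mem_union.1 hr).elim hrA hB.2

end ValidSet

/-! ### Cuts, tight sets and minimality. -/

section Flow

variable {V : Type*} [Fintype V] [DecidableEq V] {G : SimpleGraph V} [DecidableRel G.Adj]
  {R : Finset V} {r : V} {f : Finset V → ℝ} {x : G.Dart → ℝ}

/-- A valid set whose constraint in `BCR_f` is satisfied with equality. -/
def TightSet (G : SimpleGraph V) [DecidableRel G.Adj] (R : Finset V) (r : V)
    (f : Finset V → ℝ) (x : G.Dart → ℝ) (U : Finset V) : Prop :=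
  ValidSet R r U ∧ outFlow G x U = f (U ∩ R)

lemma outFlow_eq_sum_ite (x : G.Dart → ℝ) (U : Finset V) :
    outFlow G x U = ∑ a : G.Dart, if a.fst ∈ U ∧ a.snd ∉ U then x a else 0 :=
  Finset.sum_filter _ _

lemma outFlow_sub_smul (x y : G.Dart → ℝ) (c : ℝ) (U : Finset V) :
    outFlow G (x - c • y) U = outFlow G x U - c * outFlow G y U := by
  simp [outFlow, Finset.sum_sub_distrib, Finset.mul_sum]

lemma outFlow_single (a : G.Dart) (U : Finset V) :
    outFlow G (Pi.single a 1) U = if a.fst ∈ U ∧ a.snd ∉ U then 1 else 0 := by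
  classical
  rw [outFlow_eq_sum_ite, Finset.sum_eq_single a]
  · simp
  · intro b _ hb
    simp [Pi.single_eq_of_ne hb]
  · simp

/-- Decreasing a positive arc would violate the constraint of a tight set that it leaves. -/
lemma minimal_of_forall_exists_tightSet (hx : FeasibleBCR G R r f x)
    (h : ∀ a, 0 < x a → ∃ U, TightSet G R r f x U ∧ a.fst ∈ U ∧ a.snd ∉ U) :
    Minimal (FeasibleBCR G R r f) x := by
  refine ⟨hx, fun y hy hyx a => ?_⟩
  by_contra! hlt
  obtain ⟨U, ⟨hU, hUt⟩, ha⟩ := h a ((hy.1 a).trans_lt hlt)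
  have : outFlow G y U < outFlow G x U :=
    Finset.sum_lt_sum (fun b _ => hyx b) ⟨a, by simpa using ha, hlt⟩
  linarith [hy.2 U hU]

/-- If `y` is positive only where `x` is, then a small step from `x` in direction `-y` keeps the
vector nonnegative and violates no constraint that is not tight. -/
lemma exists_pos_forall_step (hx : FeasibleBCR G R r f x) (y : G.Dart → ℝ)
    (hy : ∀ a, 0 < y a → 0 < x a) :
    ∃ c : ℝ, 0 < c ∧ (∀ a, 0 ≤ x a - c * y a) ∧
      ∀ U, f (U ∩ R) < outFlow G x U → f (U ∩ R) ≤ outFlow G x U - c * outFlow G y U := by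
  -- A strict inequality survives all small positive steps; there are only finitely many arcs and
  -- sets to satisfy at once.
  have hcont : ∀ p q s : ℝ, s < p → ∀ᶠ c in nhdsWithin (0 : ℝ) (Set.Ioi 0), s ≤ p - c * q := by
    intro p q s hsp
    have ht : Filter.Tendsto (fun c : ℝ => p - c * q) (nhdsWithin 0 (Set.Ioi 0)) (nhds p) := by
      have : Continuous fun c : ℝ => p - c * q := by fun_prop
      simpa using (this.tendsto 0).mono_left nhdsWithin_le_nhds
    exact (ht.eventually (lt_mem_nhds hsp)).mono fun _ h => h.le
  have h1 : ∀ᶠ c in nhdsWithin (0 : ℝ) (Set.Ioi 0), ∀ a, 0 ≤ x a - c * y a := by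
    rw [Filter.eventually_all]
    intro a
    by_cases ha : 0 < y a
    · exact hcont _ _ _ (hy a ha)
    · filter_upwards [self_mem_nhdsWithin] with c hc
      have := mul_nonneg (le_of_lt (Set.mem_Ioi.1 hc)) (neg_nonneg.2 (not_lt.1 ha))
      linarith [hx.1 a]
  have h2 : ∀ᶠ c in nhdsWithin (0 : ℝ) (Set.Ioi 0), ∀ U : Finset V,
      f (U ∩ R) < outFlow G x U → f (U ∩ R) ≤ outFlow G x U - c * outFlow G y U := by
    rw [Filter.eventually_all]
    intro U
    by_cases hU : f (U ∩ R) < outFlow G x U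
    · exact (hcont _ _ _ hU).mono fun _ h _ => h
    · exact Filter.Eventually.of_forall fun _ h => absurd h hU
  obtain ⟨c, ⟨hc1, hc2⟩, hc⟩ := ((h1.and h2).and self_mem_nhdsWithin).exists
  exact ⟨c, hc, hc1, hc2⟩

/-- Otherwise only slack constraints involve `a`, and `x a` could be decreased slightly. -/
lemma exists_tightSet_of_minimal (hx : Minimal (FeasibleBCR G R r f) x) {a : G.Dart}
    (ha : 0 < x a) : ∃ U, TightSet G R r f x U ∧ a.fst ∈ U ∧ a.snd ∉ U := by
  classical
  by_contra! hno
  obtain ⟨c, hc, hc1, hc2⟩ := exists_pos_forall_step hx.1 (Pi.single a 1) (by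
    intro b hb
    by_cases hba : b = a
    · rwa [hba]
    · simp [Pi.single_eq_of_ne hba] at hb)
  have hfeas : FeasibleBCR G R r f (x - c • Pi.single a 1) := by
    refine ⟨fun b => by simpa using hc1 b, fun U hU => ?_⟩
    rw [outFlow_sub_smul]
    rcases (hx.1.2 U hU).lt_or_eq with h | h
    · exact hc2 U h
    · rw [outFlow_single, if_neg (fun h' => h'.2 (hno U ⟨hU, h.symm⟩ h'.1))]
      linarith
  have hle : x - c • Pi.single a 1 ≤ x := by
    intro b
    have : (0 : ℝ) ≤ Pi.single (M := fun _ => ℝ) a 1 b := by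
      by_cases hba : b = a
      · rw [hba]; simp
      · simp [Pi.single_eq_of_ne hba]
    simpa using mul_nonneg hc.le this
  have := hx.2 hfeas hle a
  simp at this
  linarith

lemma outFlow_inter_add_outFlow_union_add_le (hx : ∀ a, 0 ≤ x a) {A B : Finset V} {a : G.Dart}
    (h1A : a.fst ∈ A) (h1B : a.fst ∉ B) (h2A : a.snd ∉ A) (h2B : a.snd ∈ B) :
    outFlow G x (A ∩ B) + outFlow G x (A ∪ B) + x a ≤ outFlow G x A + outFlow G x B := by
  classical
  have hxa : x a = ∑ b : G.Dart, if b = a then x b else 0 := by simp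
  rw [hxa]
  simp only [outFlow_eq_sum_ite, ← Finset.sum_add_distrib]
  refine Finset.sum_le_sum fun b _ => ?_
  by_cases hb : b = a
  · subst hb
    simp [h1A, h1B, h2A, h2B]
  · have := hx b
    simp only [Finset.mem_inter, Finset.mem_union, hb, if_false]
    by_cases p : b.fst ∈ A <;> by_cases q : b.fst ∈ B <;> by_cases s : b.snd ∈ A <;>
      by_cases t : b.snd ∈ B <;> simp [p, q, s, t, this]

lemma outFlow_inter_add_outFlow_union_le (hx : ∀ a, 0 ≤ x a) (A B : Finset V) :
    outFlow G x (A ∩ B) + outFlow G x (A ∪ B) ≤ outFlow G x A + outFlow G x B := by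
  simp only [outFlow_eq_sum_ite, ← Finset.sum_add_distrib]
  refine Finset.sum_le_sum fun b _ => ?_
  have := hx b
  simp only [Finset.mem_inter, Finset.mem_union]
  by_cases p : b.fst ∈ A <;> by_cases q : b.fst ∈ B <;> by_cases s : b.snd ∈ A <;>
    by_cases t : b.snd ∈ B <;> simp [p, q, s, t, this]

/-! ### Uncrossing tight sets. -/

section Uncrossing

variable {A B : Finset V}

/-- Combined with submodularity of `outFlow`, these inequalities must all be equalities. -/
lemma TightSet.le_outFlow (hf : IntersectingSupermodular R f) (hx : FeasibleBCR G R r f x)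
    (hA : TightSet G R r f x A) (hB : TightSet G R r f x B) (h : (A ∩ B ∩ R).Nonempty) :
    f (A ∩ B ∩ R) ≤ outFlow G x (A ∩ B) ∧ f ((A ∪ B) ∩ R) ≤ outFlow G x (A ∪ B) ∧
      outFlow G x A + outFlow G x B ≤ f (A ∩ B ∩ R) + f ((A ∪ B) ∩ R) := by
  refine ⟨hx.2 _ (hA.1.inter h), hx.2 _ (hA.1.union hB.1), ?_⟩
  have hi : A ∩ R ∩ (B ∩ R) = A ∩ B ∩ R := by grind
  have hu : A ∩ R ∪ B ∩ R = (A ∪ B) ∩ R := by grind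
  have := hf (A := A ∩ R) (B := B ∩ R) Finset.inter_subset_right Finset.inter_subset_right
    (by rwa [hi])
  rw [hi, hu] at this
  rwa [hA.2, hB.2]

lemma TightSet.inter (hf : IntersectingSupermodular R f) (hx : FeasibleBCR G R r f x)
    (hA : TightSet G R r f x A) (hB : TightSet G R r f x B) (h : (A ∩ B ∩ R).Nonempty) :
    TightSet G R r f x (A ∩ B) := by
  obtain ⟨h1, h2, h3⟩ := hA.le_outFlow hf hx hB h
  have := outFlow_inter_add_outFlow_union_le hx.1 A B
  exact ⟨hA.1.inter h, by linarith⟩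

lemma TightSet.union (hf : IntersectingSupermodular R f) (hx : FeasibleBCR G R r f x)
    (hA : TightSet G R r f x A) (hB : TightSet G R r f x B) (h : (A ∩ B ∩ R).Nonempty) :
    TightSet G R r f x (A ∪ B) := by
  obtain ⟨h1, h2, h3⟩ := hA.le_outFlow hf hx hB h
  have := outFlow_inter_add_outFlow_union_le hx.1 A B
  exact ⟨hA.1.union hB.1, by linarith⟩

/-- No arc of positive value joins the two differences of intersecting tight sets. -/
lemma TightSet.snd_notMem (hf : IntersectingSupermodular R f) (hx : FeasibleBCR G R r f x)
    (hA : TightSet G R r f x A) (hB : TightSet G R r f x B) (h : (A ∩ B ∩ R).Nonempty)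
    {a : G.Dart} (ha : 0 < x a) (h1A : a.fst ∈ A) (h1B : a.fst ∉ B) (h2A : a.snd ∉ A) :
    a.snd ∉ B := by
  intro h2B
  obtain ⟨h1, h2, h3⟩ := hA.le_outFlow hf hx hB h
  have := outFlow_inter_add_outFlow_union_add_le hx.1 h1A h1B h2A h2B
  linarith

end Uncrossing

/-! ### Flow balance at a Steiner vertex. -/

/-- The total value of `x` on the arcs from `v` to the complement of `S`. -/
def flowOutOf (x : G.Dart → ℝ) (v : V) (S : Finset V) : ℝ :=
  ∑ a : G.Dart, if a.fst = v ∧ a.snd ∉ S then x a else 0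

/-- The total value of `x` on the arcs from `S` to `v`. -/
def flowInto (x : G.Dart → ℝ) (v : V) (S : Finset V) : ℝ :=
  ∑ a : G.Dart, if a.snd = v ∧ a.fst ∈ S then x a else 0

lemma outFlow_insert {v : V} {S : Finset V} (hv : v ∉ S) :
    outFlow G x (insert v S) = outFlow G x S + flowOutOf x v S - flowInto x v S := by
  simp only [outFlow_eq_sum_ite, flowOutOf, flowInto, ← Finset.sum_add_distrib,
    ← Finset.sum_sub_distrib]
  refine Finset.sum_congr rfl fun a _ => ?_
  have hne := a.adj.ne
  by_cases p : a.fst = v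
  · have q : a.snd ≠ v := fun q => hne (p.trans q.symm)
    have s : a.fst ∉ S := p ▸ hv
    simp [p, q, hv]
  · by_cases q : a.snd = v
    · simp [p, q, hv]
    · simp [p, q]

section Steiner

variable {v : V} {S T : Finset V}

/-- All neighbors of a Steiner vertex are terminals. -/
lemma flowOutOf_congr (hG : QuasiBipartite G R) (hv : v ∉ R) (h : S ∩ R = T ∩ R) :
    flowOutOf x v S = flowOutOf x v T := by
  refine Finset.sum_congr rfl fun a _ => ?_
  by_cases p : a.fst = v
  · have hR : a.snd ∈ R := (hG a.adj).resolve_left (p ▸ hv)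
    have : a.snd ∈ S ↔ a.snd ∈ T := by
      have := Finset.ext_iff.1 h a.snd
      simpa [hR] using this
    simp [this]
  · simp [p]

lemma flowInto_congr (hG : QuasiBipartite G R) (hv : v ∉ R) (h : S ∩ R = T ∩ R) :
    flowInto x v S = flowInto x v T := by
  refine Finset.sum_congr rfl fun a _ => ?_
  by_cases p : a.snd = v
  · have hR : a.fst ∈ R := (hG a.adj).resolve_right (p ▸ hv)
    have : a.fst ∈ S ↔ a.fst ∈ T := by
      have := Finset.ext_iff.1 h a.fst
      simpa [hR] using this
    simp [this]
  · simp [p]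

lemma flowOutOf_anti (hx : ∀ a, 0 ≤ x a) (h : S ⊆ T) : flowOutOf x v T ≤ flowOutOf x v S := by
  refine Finset.sum_le_sum fun a _ => ?_
  by_cases p : a.fst = v ∧ a.snd ∉ T
  · rw [if_pos p, if_pos ⟨p.1, fun q => p.2 (h q)⟩]
  · rw [if_neg p]
    split_ifs
    exacts [hx a, le_rfl]

lemma le_flowOutOf (hx : ∀ a, 0 ≤ x a) {a : G.Dart} (h1 : a.fst = v) (h2 : a.snd ∉ S) :
    x a ≤ flowOutOf x v S := by
  have : x a = if a.fst = v ∧ a.snd ∉ S then x a else 0 := by rw [if_pos ⟨h1, h2⟩]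
  rw [this]
  exact Finset.single_le_sum
    (f := fun b : G.Dart => if b.fst = v ∧ b.snd ∉ S then x b else 0)
    (fun b _ => by split_ifs; exacts [hx b, le_rfl]) (Finset.mem_univ a)

lemma flowInto_add_le (hG : QuasiBipartite G R) (hv : v ∉ R) (hx : ∀ a, 0 ≤ x a)
    {A B : Finset V} (hA : A ⊆ S) (hB : B ⊆ S) (hAB : ∀ t ∈ R, t ∈ A → t ∉ B) :
    flowInto x v A + flowInto x v B ≤ flowInto x v S := by
  simp only [flowInto, ← Finset.sum_add_distrib]
  refine Finset.sum_le_sum fun a _ => ?_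
  by_cases p : a.snd = v
  · have hR : a.fst ∈ R := (hG a.adj).resolve_right (p ▸ hv)
    have := hx a
    by_cases q : a.fst ∈ A
    · simp [p, q, hA q, hAB _ hR q]
    · by_cases s : a.fst ∈ B
      · simp [p, q, s, hB s]
      · by_cases t : a.fst ∈ S <;> simp [p, q, s, t, this]
  · simp [p]

/-- Removing `v` keeps the requirement, so it cannot decrease the cut of a tight set. -/
lemma flowOutOf_le_flowInto_of_tightSet (hG : QuasiBipartite G R) (hx : FeasibleBCR G R r f x)
    (hv : v ∉ R) (hT : TightSet G R r f x T) (hvT : v ∈ T) :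
    flowOutOf x v T ≤ flowInto x v T := by
  have hR : T.erase v ∩ R = T ∩ R := by grind
  have hval : ValidSet R r (T.erase v) := by
    obtain ⟨⟨⟨t, ht, htR⟩, hr⟩, -⟩ := hT
    refine ⟨⟨t, Finset.mem_erase.2 ⟨fun h => hv (h ▸ htR), ht⟩, htR⟩, fun h => hr ?_⟩
    exact Finset.mem_of_mem_erase h
  have h1 := hx.2 _ hval
  have h2 := outFlow_insert (G := G) (x := x) (Finset.notMem_erase v T)
  rw [Finset.insert_erase hvT, flowOutOf_congr hG hv hR, flowInto_congr hG hv hR] at h2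
  rw [hR] at h1
  linarith [hT.2]

/-- Adding `v` keeps the requirement; the set stays valid since `v` is not the root. -/
lemma flowInto_le_flowOutOf_of_tightSet (hx : FeasibleBCR G R r f x)
    (hv : v ∉ R) (hr : r ∈ R) (hS : TightSet G R r f x S) (hvS : v ∉ S) :
    flowInto x v S ≤ flowOutOf x v S := by
  have hR : insert v S ∩ R = S ∩ R := by grind
  have hval : ValidSet R r (insert v S) := by
    obtain ⟨⟨⟨t, ht, htR⟩, hrS⟩, -⟩ := hS
    refine ⟨⟨t, Finset.mem_insert_of_mem ht, htR⟩, fun h => ?_⟩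
    rcases Finset.mem_insert.1 h with rfl | h
    exacts [hv hr, hrS h]
  have h1 := hx.2 _ hval
  have h2 := outFlow_insert (G := G) (x := x) hvS
  rw [hR] at h1
  linarith [hS.2]

/-- A tight set avoiding the Steiner vertex `v` and a tight set containing it that have the same
terminals force the flow through `v` to be balanced. -/
lemma flowInto_eq_flowOutOf (hG : QuasiBipartite G R) (hx : FeasibleBCR G R r f x)
    (hv : v ∉ R) (hr : r ∈ R) (hS : TightSet G R r f x S) (hvS : v ∉ S)
    (hT : TightSet G R r f x T) (hvT : v ∈ T) (hST : S ∩ R = T ∩ R) :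
    flowInto x v S = flowOutOf x v S := by
  refine le_antisymm (flowInto_le_flowOutOf_of_tightSet hx hv hr hS hvS) ?_
  rw [flowInto_congr hG hv hST, flowOutOf_congr hG hv hST]
  exact flowOutOf_le_flowInto_of_tightSet hG hx hv hT hvT

/-! ### Minimal tight sets left by the arc, and the choice of sources. -/

/-- The tight sets that an arc `a` leaves. -/
def LeavesTight (R : Finset V) (r : V) (f : Finset V → ℝ) (x : G.Dart → ℝ) (a : G.Dart)
    (U : Finset V) : Prop :=
  TightSet G R r f x U ∧ a.fst ∈ U ∧ a.snd ∉ U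

variable {vu : G.Dart}

/-- A tight set left by a positive arc out of a Steiner vertex `v` contains the tail of a positive
arc into `v`. -/
lemma exists_arc_into (hG : QuasiBipartite G R) (hx : FeasibleBCR G R r f x)
    (hv : vu.fst ∉ R) (hpos : 0 < x vu) {U : Finset V} (hU : LeavesTight R r f x vu U) :
    ∃ a : G.Dart, a.snd = vu.fst ∧ a.fst ∈ U ∧ 0 < x a := by
  by_contra! hno
  have h1 := flowOutOf_le_flowInto_of_tightSet hG hx hv hU.1 hU.2.1
  have h2 := le_flowOutOf hx.1 (rfl : vu.fst = vu.fst) hU.2.2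
  have h3 : flowInto x vu.fst U ≤ 0 := by
    refine Finset.sum_nonpos fun a _ => ?_
    split_ifs with h
    exacts [hno a h.1 h.2, le_rfl]
  linarith

/-- Distinct minimal tight sets left by an arc have no terminal in common. -/
lemma terminals_disjoint_of_minimal (hf : IntersectingSupermodular R f)
    (hx : FeasibleBCR G R r f x) {A B : Finset V} (hA : Minimal (LeavesTight R r f x vu) A)
    (hB : Minimal (LeavesTight R r f x vu) B) (hAB : A ≠ B) : ∀ t ∈ R, t ∈ A → t ∉ B := by
  intro t htR htA htB
  have hne : (A ∩ B ∩ R).Nonempty := ⟨t, by simp [htR, htA, htB]⟩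
  have hI : LeavesTight R r f x vu (A ∩ B) :=
    ⟨hA.1.1.inter hf hx hB.1.1 hne, Finset.mem_inter.2 ⟨hA.1.2.1, hB.1.2.1⟩,
      fun h => hA.1.2.2 (Finset.mem_inter.1 h).1⟩
  exact hAB ((hA.eq_of_le hI Finset.inter_subset_left).symm.trans
    (hB.eq_of_le hI Finset.inter_subset_right))

/-- Uncrossing makes `(S ∪ A) ∩ B` a tight set left by the arc, so it equals `B` by minimality;
terminals of `B` are not in `A`, hence lie in `S`. -/
lemma terminals_subset_of_minimal (hf : IntersectingSupermodular R f)
    (hx : FeasibleBCR G R r f x) {A B : Finset V} (hA : Minimal (LeavesTight R r f x vu) A)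
    (hB : Minimal (LeavesTight R r f x vu) B) (hAB : A ≠ B)
    (hS : TightSet G R r f x S)
    (hSA : (S ∩ A ∩ R).Nonempty) (hSB : (S ∩ B ∩ R).Nonempty) : B ∩ R ⊆ S := by
  have hdisj := terminals_disjoint_of_minimal hf hx hA hB hAB
  have hne : ((S ∪ A) ∩ B ∩ R).Nonempty := hSB.mono (by grind)
  have hI : LeavesTight R r f x vu ((S ∪ A) ∩ B) :=
    ⟨(hS.union hf hx hA.1.1 hSA).inter hf hx hB.1.1 hne,
      Finset.mem_inter.2 ⟨Finset.mem_union_right _ hA.1.2.1, hB.1.2.1⟩,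
      fun h => hB.1.2.2 (Finset.mem_inter.1 h).2⟩
  have heq := hB.eq_of_le hI Finset.inter_subset_right
  intro t ht
  rw [Finset.mem_inter] at ht
  have htB := ht.1
  rw [← heq, Finset.mem_inter, Finset.mem_union] at htB
  exact htB.1.resolve_right fun htA => hdisj t ht.2 htA ht.1

/-- A tight set avoiding both ends of the arc meets at most one minimal tight set left by the arc
in a terminal. -/
lemma eq_of_minimal_of_inter_nonempty (hG : QuasiBipartite G R) (hr : r ∈ R)
    (hf : IntersectingSupermodular R f) (hx : FeasibleBCR G R r f x) (hv : vu.fst ∉ R)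
    (hpos : 0 < x vu) {A B : Finset V} (hA : Minimal (LeavesTight R r f x vu) A)
    (hB : Minimal (LeavesTight R r f x vu) B)
    (hS : TightSet G R r f x S) (hvS : vu.fst ∉ S) (huS : vu.snd ∉ S)
    (hSA : (S ∩ A ∩ R).Nonempty) (hSB : (S ∩ B ∩ R).Nonempty) : A = B := by
  by_contra hAB
  have hBS := terminals_subset_of_minimal hf hx hA hB hAB hS hSA hSB
  have hAS := terminals_subset_of_minimal hf hx hB hA (Ne.symm hAB) hS hSB hSA
  have hdisj := terminals_disjoint_of_minimal hf hx hA hB hAB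
  -- Since `A ∩ R ⊆ S`, the sets `S` and `S ∪ A` have the same terminals.
  have hbS : flowInto x vu.fst S = flowOutOf x vu.fst S :=
    flowInto_eq_flowOutOf hG hx hv hr hS hvS (hS.union hf hx hA.1.1 hSA)
      (Finset.mem_union_right _ hA.1.2.1) (by grind)
  have hbal : ∀ C, LeavesTight R r f x vu C → (S ∩ C ∩ R).Nonempty → C ∩ R ⊆ S →
      flowInto x vu.fst (S ∩ C) = flowOutOf x vu.fst (S ∩ C) := fun C hC hSC hCS =>
    flowInto_eq_flowOutOf hG hx hv hr (hS.inter hf hx hC.1 hSC)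
      (fun h => hvS (Finset.mem_inter.1 h).1) hC.1 hC.2.1 (by grind)
  have hbA := hbal A hA.1 hSA hAS
  have hbB := hbal B hB.1 hSB hBS
  -- The inflow from `S` is at least the inflows from `S ∩ A` and `S ∩ B` together, hence at least
  -- twice the outflow past `S`. It also equals that outflow, which is at least `x vu > 0`.
  have h1 : flowOutOf x vu.fst S ≤ flowOutOf x vu.fst (S ∩ A) :=
    flowOutOf_anti hx.1 Finset.inter_subset_left
  have h2 : flowOutOf x vu.fst S ≤ flowOutOf x vu.fst (S ∩ B) :=
    flowOutOf_anti hx.1 Finset.inter_subset_left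
  have h3 : flowInto x vu.fst (S ∩ A) + flowInto x vu.fst (S ∩ B) ≤ flowInto x vu.fst S :=
    flowInto_add_le hG hv hx.1 Finset.inter_subset_left Finset.inter_subset_left
      (fun t htR htA htB => hdisj t htR (Finset.mem_inter.1 htA).2 (Finset.mem_inter.1 htB).2)
  have h4 := le_flowOutOf hx.1 (rfl : vu.fst = vu.fst) huS
  linarith

/-- `W` consists of one tail per minimal tight set left by `vu`. The conditions are what the star on
`W` needs to meet each tight set in the right number of arcs. -/
lemma exists_source_set (hG : QuasiBipartite G R) (hr : r ∈ R)
    (hf : IntersectingSupermodular R f) (hx : FeasibleBCR G R r f x) (hv : vu.fst ∉ R)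
    (hpos : 0 < x vu) :
    ∃ W : Set V, (∀ w ∈ W, ∃ a : G.Dart, a.fst = w ∧ a.snd = vu.fst ∧ 0 < x a) ∧
      (∀ U, LeavesTight R r f x vu U → ∃ w ∈ W, w ∈ U) ∧ vu.snd ∉ W ∧
      (∀ U, TightSet G R r f x U → vu.fst ∉ U → ∀ w ∈ W, w ∈ U → vu.snd ∉ U) ∧
      (∀ U, TightSet G R r f x U → vu.fst ∉ U → ∀ w ∈ W, w ∈ U → ∀ w' ∈ W, w' ∈ U → w = w') := by
  have hex : ∀ M : Finset V, ∃ a : G.Dart, Minimal (LeavesTight R r f x vu) M →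
      a.snd = vu.fst ∧ a.fst ∈ M ∧ 0 < x a := by
    intro M
    by_cases hM : Minimal (LeavesTight R r f x vu) M
    · obtain ⟨a, ha⟩ := exists_arc_into hG hx hv hpos hM.1
      exact ⟨a, fun _ => ha⟩
    -- For non-minimal `M` the arc `vu` is an arbitrary filler.
    · exact ⟨vu, fun h => absurd h hM⟩
  choose c hc using hex
  have hcR : ∀ M, Minimal (LeavesTight R r f x vu) M → (c M).fst ∈ R := fun M hM =>
    (hG (c M).adj).resolve_right ((hc M hM).1 ▸ hv)
  have hne : ∀ U M, Minimal (LeavesTight R r f x vu) M → (c M).fst ∈ U →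
      (U ∩ M ∩ R).Nonempty := fun U M hM h =>
    ⟨(c M).fst, by simp [h, (hc M hM).2.1, hcR M hM]⟩
  have hsnd : ∀ U, TightSet G R r f x U → vu.fst ∉ U →
      ∀ M, Minimal (LeavesTight R r f x vu) M → (c M).fst ∈ U → vu.snd ∉ U := by
    intro U hU hvU M hM h
    -- If `U` contained the head of `vu`, this positive arc would run from `M \ U` to `U \ M`.
    refine hM.1.1.snd_notMem hf hx hU ?_ hpos hM.1.2.1 hvU hM.1.2.2
    rw [Finset.inter_comm M U]
    exact hne U M hM h
  refine ⟨{w | ∃ M, Minimal (LeavesTight R r f x vu) M ∧ (c M).fst = w}, ?_, ?_, ?_, ?_, ?_⟩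
  · rintro w ⟨M, hM, rfl⟩
    exact ⟨c M, rfl, (hc M hM).1, (hc M hM).2.2⟩
  · intro U hU
    obtain ⟨M, hMU, hM⟩ :=
      (Set.toFinite {U | LeavesTight R r f x vu U}).exists_le_minimal hU
    exact ⟨_, ⟨M, hM, rfl⟩, hMU (hc M hM).2.1⟩
  · rintro ⟨M, hM, h⟩
    exact hM.1.2.2 (h ▸ (hc M hM).2.1)
  · rintro U hU hvU w ⟨M, hM, rfl⟩ hw
    exact hsnd U hU hvU M hM hw
  · rintro U hU hvU w ⟨M, hM, rfl⟩ hw w' ⟨M', hM', rfl⟩ hw'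
    rw [eq_of_minimal_of_inter_nonempty hG hr hf hx hv hpos hM hM' hU hvU
      (hsnd U hU hvU M hM hw) (hne U M hM hw) (hne U M' hM' hw')]

end Steiner

/-! ### Splitting off a multiple of a component. -/

lemma outFlow_chi_eq_zero {K : DirectedFullComponent G R} {U : Finset V}
    (h : ∀ b ∈ K.arcs, b.fst ∈ U → b.snd ∈ U) : outFlow G K.chi U = 0 := by
  refine Finset.sum_eq_zero fun b hb => Set.indicator_of_notMem (fun hbK => ?_) _
  simp only [Finset.mem_filter, Finset.mem_univ, true_and] at hb
  exact hb.2 (h b hbK hb.1)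

lemma outFlow_chi_eq_one {K : DirectedFullComponent G R} {U : Finset V} {a : G.Dart}
    (ha : a ∈ K.arcs) (h1 : a.fst ∈ U) (h2 : a.snd ∉ U)
    (h : ∀ b ∈ K.arcs, b.fst ∈ U → b.snd ∉ U → b = a) : outFlow G K.chi U = 1 := by
  rw [outFlow, Finset.sum_eq_single a]
  · simp [DirectedFullComponent.chi, ha]
  · intro b hb hba
    simp only [Finset.mem_filter, Finset.mem_univ, true_and] at hb
    exact Set.indicator_of_notMem (fun hbK => hba (h b hbK hb.1 hb.2)) _
  · intro hna
    simp [h1, h2] at hna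

open scoped Classical in
/-- If every tight set is left by exactly as much of `χ_K` as its requirement decreases, then a
small multiple of `χ_K` can be split off. -/
lemma exists_minimal_sub_smul_chi (hx : Minimal (FeasibleBCR G R r f) x)
    (K : DirectedFullComponent G R) (hK : ∀ a ∈ K.arcs, 0 < x a)
    (htight : ∀ U, TightSet G R r f x U →
      outFlow G K.chi U = if K.Crosses (U ∩ R) then 1 else 0) :
    ∃ lam : ℝ, 0 < lam ∧
      Minimal (FeasibleBCR G R r (lowerOnCrossed f lam K)) (x - lam • K.chi) := by
  obtain ⟨c, hc, hc1, hc2⟩ := exists_pos_forall_step hx.1 K.chi (fun a ha => by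
    by_contra hxa
    have : K.chi a = 0 := Set.indicator_of_notMem (fun h => hxa (hK a h)) _
    linarith)
  have hstay : ∀ U, TightSet G R r f x U →
      TightSet G R r (lowerOnCrossed f c K) (x - c • K.chi) U := by
    intro U hU
    refine ⟨hU.1, ?_⟩
    rw [outFlow_sub_smul, htight U hU, hU.2, lowerOnCrossed]
    split_ifs <;> ring
  refine ⟨c, hc, minimal_of_forall_exists_tightSet ⟨fun a => by simpa using hc1 a, ?_⟩ ?_⟩
  · intro U hU
    rcases (hx.1.2 U hU).lt_or_eq with h | h
    · rw [outFlow_sub_smul]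
      -- Slack constraints keep even their old requirement, and the new one is no larger.
      refine le_trans ?_ (hc2 U h)
      rw [lowerOnCrossed]
      split_ifs <;> linarith
    · exact (hstay U ⟨hU, h.symm⟩).2.ge
  · intro a ha
    have hchi : 0 ≤ K.chi a := Set.indicator_nonneg (fun _ _ => zero_le_one) a
    have hxa : 0 < x a := by
      have := mul_nonneg hc.le hchi
      simp only [Pi.sub_apply, Pi.smul_apply, smul_eq_mul] at ha
      linarith
    obtain ⟨U, hU, ha⟩ := exists_tightSet_of_minimal hx hxa
    exact ⟨U, hstay U hU, ha⟩

end Flow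

/-! ### The star on the chosen sources. -/

theorem lemma5 {V : Type*} [Fintype V] [DecidableEq V] (G : SimpleGraph V) [DecidableRel G.Adj]
    (R : Finset V) (r : V) (hr : r ∈ R) (hG : QuasiBipartite G R)
    (f : Finset V → ℝ) (hf : IntersectingSupermodular R f)
    (x : G.Dart → ℝ) (hx : Minimal (FeasibleBCR G R r f) x)
    (vu : G.Dart) (hv : vu.fst ∉ R) (hu : vu.snd ∈ R) (hpos : 0 < x vu) :
    (∃ lam : ℝ, 0 < lam ∧ ∃ K : DirectedFullComponent G R, vu ∈ K.arcs ∧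
      Minimal (FeasibleBCR G R r (lowerOnCrossed f lam K)) (x - lam • K.chi)) ∧
    (∀ lam : ℝ, 0 < lam → ∀ K : DirectedFullComponent G R, vu ∈ K.arcs →
      Minimal (FeasibleBCR G R r (lowerOnCrossed f lam K)) (x - lam • K.chi) →
      IntersectingSupermodular R (lowerOnCrossed f lam K)) := by
  refine ⟨?_, fun lam hlam K _ _ => hf.lowerOnCrossed hlam.le K⟩
  obtain ⟨W, hWarc, hWhit, huW, hWsnd, hWone⟩ := exists_source_set hG hr hf hx.1 hv hpos
  have hWadj : ∀ w ∈ insert vu.snd W, G.Adj vu.fst w := by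
    rintro w (rfl | hw)
    · exact vu.adj
    · obtain ⟨a, rfl, ha, -⟩ := hWarc w hw
      exact ha ▸ a.adj.symm
  have hWR : ∀ w ∈ insert vu.snd W, w ∈ R := fun w hw => (hG (hWadj w hw)).resolve_left hv
  -- The centre must not be a leaf: some tight set is left by `vu`, so `W` is nonempty, and it omits
  -- the sink.
  have hcard : (insert vu.snd W).ncard ≠ 1 := by
    obtain ⟨U, hU, hU'⟩ := exists_tightSet_of_minimal hx hpos
    obtain ⟨w, hw, -⟩ := hWhit U ⟨hU, hU'⟩
    intro h
    obtain ⟨z, hz⟩ := Set.ncard_eq_one.1 h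
    have h1 : vu.snd = z := by simpa [hz] using Set.mem_insert vu.snd W
    have h2 : w = z := by simpa [hz] using Set.mem_insert_of_mem vu.snd hw
    exact huW (h1.trans h2.symm ▸ hw)
  let K : DirectedFullComponent G R :=
    starComponent vu.fst (insert vu.snd W) hWadj hv hWR hcard vu.snd (Set.mem_insert _ _)
  have hKarcs : ∀ a : G.Dart, a ∈ K.arcs ↔ a = vu ∨ (a.fst ∈ W ∧ a.snd = vu.fst) := by
    intro a
    refine mem_arcs_starComponent.trans (or_congr ⟨fun h => ?_, ?_⟩ ?_)
    · exact SimpleGraph.Dart.ext _ _ (Prod.ext h.1 h.2)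
    · rintro rfl
      exact ⟨rfl, rfl⟩
    · constructor
      · rintro ⟨h1, h2, h3⟩
        exact ⟨h1.resolve_left h2, h3⟩
      · rintro ⟨h1, h3⟩
        exact ⟨Set.mem_insert_of_mem _ h1, fun h => huW (h ▸ h1), h3⟩
  have hcross : ∀ U : Finset V, K.Crosses (U ∩ R) ↔ vu.snd ∉ U ∧ ∃ w ∈ W, w ∈ U := by
    intro U
    have hsink : K.sink = vu.snd := rfl
    have hsrc : ∀ w, w ∈ K.sources ↔ w ∈ W := by
      intro w
      constructor
      · rintro ⟨h | h | h, h2, h3⟩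
        · exact absurd (h ▸ h2) hv
        · exact absurd h h3
        · exact h
      · intro h
        exact ⟨Or.inr (Or.inr h), hWR w (Or.inr h), fun h' => huW (hsink ▸ h' ▸ h)⟩
    simp only [DirectedFullComponent.Crosses, hsink, hsrc, Finset.mem_inter, hu, and_true]
    refine and_congr_right fun _ => exists_congr fun w => and_congr_right fun hw => ?_
    simp [hWR w (Or.inr hw)]
  obtain ⟨lam, hlam, hmin⟩ := exists_minimal_sub_smul_chi hx K (by
    intro a ha
    rcases (hKarcs a).1 ha with rfl | ⟨h1, h2⟩
    · exact hpos
    · obtain ⟨b, hb1, hb2, hb⟩ := hWarc _ h1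
      rwa [SimpleGraph.Dart.ext a b (Prod.ext hb1.symm (h2.trans hb2.symm))]) (by
    intro U hU
    rw [hcross]
    -- A set containing the centre can be left only by `vu`, a set avoiding it only by arcs from `W`
    -- to the centre.
    by_cases hvU : vu.fst ∈ U
    · by_cases huU : vu.snd ∈ U
      · rw [if_neg (fun h => h.1 huU)]
        refine outFlow_chi_eq_zero fun b hb _ => ?_
        rcases (hKarcs b).1 hb with rfl | ⟨-, h2⟩
        exacts [huU, h2 ▸ hvU]
      · rw [if_pos ⟨huU, hWhit U ⟨hU, hvU, huU⟩⟩]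
        refine outFlow_chi_eq_one ((hKarcs vu).2 (Or.inl rfl)) hvU huU fun b hb _ hb2 => ?_
        exact ((hKarcs b).1 hb).resolve_right fun h => hb2 (h.2 ▸ hvU)
    · by_cases hW : ∃ w ∈ W, w ∈ U
      · obtain ⟨w, hw, hwU⟩ := hW
        rw [if_pos ⟨hWsnd U hU hvU w hw hwU, w, hw, hwU⟩]
        obtain ⟨a, rfl, ha, -⟩ := hWarc w hw
        refine outFlow_chi_eq_one ((hKarcs a).2 (Or.inr ⟨hw, ha⟩)) hwU (ha ▸ hvU) ?_
        intro b hb hb1 hb2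
        rcases (hKarcs b).1 hb with rfl | ⟨h1, h2⟩
        · exact absurd hb1 hvU
        · exact SimpleGraph.Dart.ext _ _
            (Prod.ext (hWone U hU hvU _ h1 hb1 _ hw hwU) (h2.trans ha.symm))
      · rw [if_neg (fun h => hW h.2)]
        refine outFlow_chi_eq_zero fun b hb hb1 => ?_
        rcases (hKarcs b).1 hb with rfl | ⟨h1, -⟩
        exacts [absurd hb1 hvU, absurd ⟨_, h1, hb1⟩ hW])
  exact ⟨lam, hlam, K, (hKarcs vu).2 (Or.inl rfl), hmin⟩
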